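/- For metric spaces $M,N$ and an injective map $f\colon M\to N$ let \[ \mathrm{dist}(f)=\Big(\sup_{x\neq y\in M}\frac{d_N(f(x),f(y))}{d_M(x,y)}\Big)\Big(\sup_{x\neq y\in M}\frac{d_M(x,y)}{d_N(f(x),f(y))}\Big)\in[0,\infty], \] let $c_N(M)$ be the infimum of all real $C\ge 1$ for which there is an injective map $f\colon M\to N$ with $\mathrm{dist}(f)\le C$ (with $\inf\emptyset=\infty$), and for a class $\mathcal C$ of metric spaces put $c_N(\mathcal C)=\sup\{c_N(M): M\in\mathcal C\}$. For an ordinal $\alpha$ let $C([0,\alpha])$ be the space of continuous real-valued functions, with the supremum norm, on the set $[0,\alpha]$ of ordinals with its order topology. A real Banach space $X$ has nontrivial type if for some $1<p\le 2$ there is a constant $T$ such that $\big(\mathbb E\|\sum_{i=1}^n\varepsilon_i x_i\|^p\big)^{1/p}\le T\big(\sum_{i=1}^n\|x_i\|^p\big)^{1/p}$ for all $n$ and all $x_1,\dots,x_n\in X$, where $\varepsilon_1,\dots,\varepsilon_n$ are independent uniformly distributed signs; it has nontrivial cotype if for some $2\le q<\infty$ there is a constant $T$ such that $\big(\sum_{i=1}^n\|x_i\|^q\big)^{1/q}\le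 T\big(\mathbb E\|\sum_{i=1}^n\varepsilon_i x_i\|^q\big)^{1/q}$ for all $n$ and all $x_1,\dots,x_n\in X$. Let $\mathcal C$ be one of the following classes: all separable metric spaces; all separable real Banach spaces; all separable real Banach spaces with nontrivial cotype; all separable real Banach spaces with nontrivial type; all separable reflexive real Banach spaces. Then for every integer $k\ge 1$, \[ \frac{k+1}{k}\;\le\; c_{C([0,\omega^k])}(\mathcal C)\;\le\; 2 . \] -/

import Mathlib

open scoped ENNReal

universe u v

namespace MetricEmbed

/-- A metric space, bundled with its carrier. -/
structure MetSp : Type (u + 1) where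
  carrier : Type u
  [metric : MetricSpace carrier]

attribute [instance] MetSp.metric

/-- The distortion `‖f‖_Lip * ‖f⁻¹‖_Lip` of a map, with values in `[0, ∞]`. A map that is not
injective has no inverse on its image, and its distortion is `∞`. -/
noncomputable def distortion {M : Type u} {N : Type v} [MetricSpace M] [MetricSpace N]
    (f : M → N) : ℝ≥0∞ :=
  open Classical in
  if Function.Injective f then
    (⨆ (x : M) (y : M) (_ : x ≠ y), edist (f x) (f y) / edist x y) *
      (⨆ (x : M) (y : M) (_ : x ≠ y), edist x y / edist (f x) (f y))
  else ∞

/-- `M` embeds into `N` with distortion at most `C`. -/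
def LipEmbeds (M : Type u) (N : Type v) [MetricSpace M] [MetricSpace N] (C : ℝ) : Prop :=
  ∃ f : M → N, distortion f ≤ ENNReal.ofReal C

/-- The `N`-distortion of `M`: the infimum of all real `C ≥ 1` such that `M` embeds into `N` with
distortion at most `C` (and `∞` if there is no such `C`). -/
noncomputable def spaceDistortion (N : Type v) (M : Type u) [MetricSpace N] [MetricSpace M] :
    ℝ≥0∞ :=
  ⨅ (C : ℝ) (_ : 1 ≤ C) (_ : LipEmbeds M N C), ENNReal.ofReal C

/-- The `N`-distortion of a class `F` of metric spaces. -/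
noncomputable def classDistortion (N : Type v) [MetricSpace N] (F : Set MetSp.{u}) : ℝ≥0∞ :=
  ⨆ M ∈ F, spaceDistortion N M.carrier

section BanachSpaces

variable (X : Type u) [NormedAddCommGroup X] [NormedSpace ℝ X]

/-- The Rademacher average `𝔼 ‖∑ i, ε i • x i‖ ^ p`, the mean over all choices of signs. -/
noncomputable def rademacherMean {X : Type u} [NormedAddCommGroup X] (p : ℝ) {n : ℕ}
    (x : Fin n → X) : ℝ :=
  (∑ ε : Fin n → ℤˣ, ‖∑ i, (ε i : ℤ) • x i‖ ^ p) / 2 ^ n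

/-- Rademacher type `p`. -/
def HasType (p : ℝ) : Prop :=
  ∃ T : ℝ, ∀ (n : ℕ) (x : Fin n → X),
    rademacherMean p x ^ (1 / p) ≤ T * (∑ i, ‖x i‖ ^ p) ^ (1 / p)

/-- Rademacher cotype `q`. -/
def HasCotype (q : ℝ) : Prop :=
  ∃ C : ℝ, ∀ (n : ℕ) (x : Fin n → X),
    (∑ i, ‖x i‖ ^ q) ^ (1 / q) ≤ C * rademacherMean q x ^ (1 / q)

/-- Nontrivial type: type `p` for some `1 < p ≤ 2`. -/
def HasNontrivialType : Prop := ∃ p : ℝ, 1 < p ∧ p ≤ 2 ∧ HasType X p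

/-- Nontrivial cotype: cotype `q` for some `2 ≤ q < ∞`. -/
def HasNontrivialCotype : Prop := ∃ q : ℝ, 2 ≤ q ∧ HasCotype X q

/-- Reflexivity: the canonical map of `X` into its bidual is onto. -/
def IsReflexiveSpace : Prop :=
  Function.Surjective (NormedSpace.inclusionInDoubleDual ℝ X)

end BanachSpaces

/-- Separable metric spaces. -/
def separableMetric : Set MetSp.{u} :=
  {M | TopologicalSpace.SeparableSpace M.carrier}

/-- Separable real Banach spaces (viewed as metric spaces) with the property `P`. -/
def separableBanachWith
    (P : ∀ (X : Type u) [NormedAddCommGroup X] [NormedSpace ℝ X], Prop) : Set MetSp.{u} :=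
  {M | ∃ (X : Type u) (_ : NormedAddCommGroup X) (_ : NormedSpace ℝ X),
    CompleteSpace X ∧ TopologicalSpace.SeparableSpace X ∧ P X ∧ M = MetSp.mk X}

/-- Separable Banach spaces. -/
def separableBanach : Set MetSp.{u} := separableBanachWith fun _ _ _ => True

/-- Separable Banach spaces with nontrivial cotype. -/
def separableCotype : Set MetSp.{u} := separableBanachWith fun X _ _ => HasNontrivialCotype X

/-- Separable Banach spaces with nontrivial type. -/
def separableType : Set MetSp.{u} := separableBanachWith fun X _ _ => HasNontrivialType X

/-- Separable reflexive Banach spaces. -/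
def separableReflexive : Set MetSp.{u} := separableBanachWith fun X _ _ => IsReflexiveSpace X

/-- The space `C([0, α])` of continuous real functions, with the sup norm, on the ordinal
interval `[0, α]` with its order topology. -/
abbrev COrdinal (α : Ordinal.{0}) : Type 1 := C(Set.Icc (0 : Ordinal.{0}) α, ℝ)

end MetricEmbed

/-!
For the lower bound, let `e n` be vectors in the unit ball of `X` such that any two sums of `k + 1`
of them with disjoint supports are at distance `2 * (k + 1)`, and let `f` embed `X` into
`C([0, ω ^ k])` with Lipschitz constant `D`, not decreasing distances. Two such sums are built by
adding one vector at a time. At step `j` the new vectors `e n`, `e m` of the two sums are chosen so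
that adding either of them to the first sum gives images that nearly agree on the finite set of
points of `[0, ω ^ k]` not yet dealt with at this level of the Cantor–Bendixson hierarchy, hence on
a neighbourhood `V` of it. At the points of `V` the images of the final sums are, up to a small
error, at most `2 * k * D` apart, because the step from one new vector to the other, of length `2`,
costs nothing (`exists_disjoint_sums`). As `[0, ω ^ k]` is exhausted in `k + 1` steps
(`hasRank_Icc_opow`), `2 * (k + 1) ≤ 2 * k * D`.

A single space serves all five classes: type, cotype and reflexivity are invariant under
isomorphism, so it suffices to renorm Hilbert space. In the norm `sup ⟪s, x⟫`, taken over the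
vectors `s` of norm at most `2 * (k + 1)` with coordinates in `[-1, 1]` and combined with the
Hilbert norm, the standard basis has the required property (`exists_mem_class`).

For the upper bound, every separable metric space embeds into `c₀`, which is a subspace of
`C([0, ω ^ k])`, with distortion at most any given `C > 2` (after Kalton and Lancien). Let `x n` be
a dense sequence. For points `p`, `q` at distance `r` consider the first `n` such that the distances
of `p` and `q` to `{x m | m ≤ n}` add up to less than `r / 2`. Then one point, say `p`, is near
`x n` and the other near some `x i` with `i < n`. The sets `U`, `V` of first and second points of
all pairs in this position are at distance at least about `r / 2` (`le_dist_of_mem_pairSet`), and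
there is a `1`-Lipschitz function that vanishes at all `x m` with `m < n` and whose values on `U`
and `V` differ by about `r / 2`. Up to the choice of the scale of `r` and of finitely many
parameters there is one function for each pair `i < n`, and at any given point these functions tend
to zero (`finite_lt_abs_coord`).
-/

namespace MetricEmbed

/-! ### Scattered rank of closed ordinal intervals -/

/-- `HasRank r C` says that `C` can be exhausted in `r` steps, each of which removes an arbitrary
open neighbourhood of a finite set that may depend on the neighbourhoods removed before. For compact
`C` it amounts to the emptiness of the `r`-th Cantor–Bendixson derivative. -/
def HasRank {K : Type*} [TopologicalSpace K] : ℕ → Set K → Prop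
  | 0, C => C = ∅
  | r + 1, C => ∃ F : Set K, F.Finite ∧ ∀ V, IsOpen V → F ⊆ V → HasRank r (C \ V)

section Rank

variable {K : Type*} [TopologicalSpace K]

lemma HasRank.mono {r : ℕ} : ∀ {C C' : Set K}, HasRank r C → C' ⊆ C → HasRank r C' := by
  induction r with
  | zero => intro C C' h hs; exact Set.subset_eq_empty hs h
  | succ r ih =>
    rintro C C' ⟨F, hF, h⟩ hs
    exact ⟨F, hF, fun V hV hFV => ih (h V hV hFV) (Set.sdiff_subset_sdiff_left hs)⟩

lemma hasRank_empty (r : ℕ) : HasRank r (∅ : Set K) := by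
  induction r with
  | zero => rfl
  | succ r ih => exact ⟨∅, Set.finite_empty, fun V _ _ => by simpa using ih⟩

lemma hasRank_singleton (r : ℕ) (a : K) : HasRank (r + 1) {a} := by
  refine ⟨{a}, Set.finite_singleton a, fun V _ hV => ?_⟩
  rw [Set.sdiff_eq_empty.2 hV]
  exact hasRank_empty r

lemma HasRank.union {r : ℕ} :
    ∀ {C C' : Set K}, HasRank r C → HasRank r C' → HasRank r (C ∪ C') := by
  induction r with
  | zero => intro C C' h h'; exact Set.union_empty_iff.2 ⟨h, h'⟩
  | succ r ih =>
    rintro C C' ⟨F, hF, h⟩ ⟨F', hF', h'⟩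
    refine ⟨F ∪ F', hF.union hF', fun V hV hFV => ?_⟩
    rw [Set.union_sdiff_distrib]
    exact ih (h V hV (Set.subset_union_left.trans hFV))
      (h' V hV (Set.subset_union_right.trans hFV))

end Rank

open Ordinal in
lemma hasRank_Ioc_mul {k r : ℕ} (h : ∀ a : Ordinal.{u}, HasRank r (Set.Ioc a (a + ω ^ k)))
    (a : Ordinal.{u}) (n : ℕ) : HasRank r (Set.Ioc a (a + ω ^ k * n)) := by
  induction n with
  | zero => simpa using hasRank_empty r
  | succ n ih =>
    refine (ih.union (h (a + ω ^ k * n))).mono fun x hx => ?_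
    have e : a + ω ^ k * ((n + 1 : ℕ) : Ordinal.{u}) = a + ω ^ k * n + ω ^ k := by
      rw [Nat.cast_add, Nat.cast_one, mul_add, mul_one, add_assoc]
    rw [e] at hx
    rcases le_or_gt x (a + ω ^ k * n) with h1 | h1
    · exact Or.inl ⟨hx.1, h1⟩
    · exact Or.inr ⟨h1, hx.2⟩

/-- A neighbourhood of the right end point of `(a, a + ω ^ (k + 1)]` leaves out only finitely many
consecutive intervals of length `ω ^ k`. -/
lemma hasRank_Ioc (k : ℕ) (a : Ordinal.{u}) :
    HasRank (k + 1) (Set.Ioc a (a + Ordinal.omega0 ^ k)) := by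
  induction k generalizing a with
  | zero =>
    refine (hasRank_singleton 0 (a + 1)).mono fun x hx => ?_
    rw [pow_zero] at hx
    exact le_antisymm hx.2 (Order.add_one_le_of_lt hx.1)
  | succ k ih =>
    refine ⟨{a + Ordinal.omega0 ^ (k + 1)}, Set.finite_singleton _, fun V hV hFV => ?_⟩
    have hlt : a < a + Ordinal.omega0 ^ (k + 1) :=
      lt_add_of_pos_right a (pow_pos Ordinal.omega0_pos _)
    obtain ⟨b, hb, hbV⟩ := exists_Ioc_subset_of_mem_nhds'
      (hV.mem_nhds (hFV rfl)) hlt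
    have hb' : b - a < Ordinal.omega0 ^ k * Ordinal.omega0 := by
      rw [← pow_succ]
      exact Ordinal.sub_lt_of_lt_add hb.2 (pow_pos Ordinal.omega0_pos _)
    obtain ⟨c, hc, hbc⟩ := (Ordinal.lt_mul_iff_of_isSuccLimit Ordinal.isSuccLimit_omega0).1 hb'
    obtain ⟨n, rfl⟩ := Ordinal.lt_omega0.1 hc
    refine (hasRank_Ioc_mul ih a n).mono fun x hx => ⟨hx.1.1, ?_⟩
    by_contra hx'
    refine hx.2 (hbV ⟨?_, hx.1.2⟩)
    refine lt_of_le_of_lt ?_ (not_le.1 hx')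
    exact (Ordinal.le_add_sub b a).trans (by gcongr)

lemma hasRank_Icc_opow (k : ℕ) :
    HasRank (k + 1) (Set.Icc 0 (Ordinal.omega0.{u} ^ (k : Ordinal.{u}))) := by
  refine ((hasRank_singleton k 0).union (hasRank_Ioc k 0)).mono fun x hx => ?_
  rcases hx.1.eq_or_lt with h | h
  · exact Or.inl h.symm
  · exact Or.inr ⟨h, by simpa using hx.2⟩

/-! ### The obstruction to embeddings -/

section Tree

variable {X K : Type*} [NormedAddCommGroup X]

/-- By compactness a bounded sequence takes nearly the same values on a finite set at two
different indices, which can be taken outside any given finite set. -/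
lemma exists_ne_forall_abs_sub_lt {F : Set K} (hF : F.Finite) (h : ℕ → K → ℝ) (R : ℝ)
    (hR : ∀ n, ∀ t, |h n t - h 0 t| ≤ R) {η : ℝ} (hη : 0 < η) (M : Finset ℕ) :
    ∃ n m, n ∉ M ∧ m ∉ M ∧ n ≠ m ∧ ∀ t ∈ F, |h n t - h m t| < η := by
  have := hF.fintype
  let w : ℕ → F → ℝ := fun n t => h n t
  have hw : ∀ n, w n ∈ Metric.closedBall (w 0) (max R 0) := fun n => by
    rw [Metric.mem_closedBall, dist_pi_le_iff (le_max_right _ _)]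
    exact fun t => (hR n t).trans (le_max_left _ _)
  obtain ⟨a, -, φ, hφ, ha⟩ := tendsto_subseq_of_bounded Metric.isBounded_closedBall hw
  obtain ⟨N, hN⟩ := Metric.cauchySeq_iff.1 ha.cauchySeq η hη
  have hM : ∀ j, M.sup id + 1 ≤ j → φ j ∉ M := fun j hj hmem => by
    have h1 : φ j ≤ M.sup id := Finset.le_sup (f := id) hmem
    have h2 := hφ.id_le j
    simp only [id] at h2
    omega
  refine ⟨φ (N + M.sup id + 1), φ (N + M.sup id + 2), hM _ (by omega), hM _ (by omega),
    hφ.injective.ne (by omega), fun t ht => ?_⟩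
  have h3 := hN (N + M.sup id + 1) (by omega) (N + M.sup id + 2) (by omega)
  exact (dist_le_pi_dist _ _ (⟨t, ht⟩ : F)).trans_lt h3

/-- In a set of rank `r`, two points can be moved by `r` basis vectors each, all of them different,
so that their images get apart by no more than `r - 1` of these moves account for. At each step the
two moves of the first point are chosen to agree nearly on the finite set that has to be removed;
on the neighbourhood where they still agree the step itself costs nothing. -/
lemma exists_disjoint_sums [TopologicalSpace K] {e : ℕ → X} (he : ∀ n, ‖e n‖ ≤ 1)
    {g : X → K → ℝ} (hg : ∀ x, Continuous (g x)) {D : ℝ} (hD0 : 0 ≤ D)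
    (hD : ∀ x y t, |g x t - g y t| ≤ D * ‖x - y‖) {η : ℝ} (hη : 0 < η) (r : ℕ) :
    ∀ C : Set K, HasRank r C → ∀ (x y : X) (M : Finset ℕ), ∃ A B : Finset ℕ,
      Disjoint A B ∧ Disjoint A M ∧ Disjoint B M ∧ A.card = r ∧ B.card = r ∧
      ∀ t ∈ C, |g (x + ∑ i ∈ A, e i) t - g (y + ∑ i ∈ B, e i) t|
        ≤ D * (‖x - y‖ + 2 * r - 2) + η := by
  induction r with
  | zero =>
    rintro C rfl x y M
    exact ⟨∅, ∅, by simp⟩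
  | succ r ih =>
    rintro C ⟨F, hF, hFC⟩ x y M
    obtain ⟨n, m, hn, hm, hnm, hF'⟩ := exists_ne_forall_abs_sub_lt hF
      (fun n => g (x + e n)) (D * 2) (fun n t => by
        refine (hD _ _ t).trans (mul_le_mul_of_nonneg_left ?_ hD0)
        rw [add_sub_add_left_eq_sub]
        linarith [norm_sub_le (e n) (e 0), he n, he 0]) hη M
    let V : Set K := {t | |g (x + e n) t - g (x + e m) t| < η}
    have hV : IsOpen V := isOpen_lt (((hg _).sub (hg _)).abs) continuous_const
    obtain ⟨A, B, hAB, hA, hB, hAr, hBr, h⟩ :=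
      ih (C \ V) (hFC V hV hF') (x + e n) (y + e m) (insert n (insert m M))
    simp only [Finset.disjoint_insert_right] at hA hB
    have hsum : ∀ A : Finset ℕ, A.card = r → ‖∑ i ∈ A, e i‖ ≤ r := fun A hA => by
      refine (norm_sum_le _ _).trans ((Finset.sum_le_sum fun i _ => he i).trans ?_)
      simp [hA]
    refine ⟨insert n A, insert m B, ?_, ?_, ?_, ?_, ?_, fun t ht => ?_⟩
    · simp [Finset.disjoint_insert_left, Finset.disjoint_insert_right, hA, hB, hAB, hnm.symm]
    · simp [Finset.disjoint_insert_left, hn, hA]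
    · simp [Finset.disjoint_insert_left, hm, hB]
    · rw [Finset.card_insert_of_notMem hA.1, hAr]
    · rw [Finset.card_insert_of_notMem hB.2.1, hBr]
    rw [Finset.sum_insert hA.1, Finset.sum_insert hB.2.1, ← add_assoc, ← add_assoc]
    by_cases htV : t ∈ V
    · have h1 := hD (x + e n + ∑ i ∈ A, e i) (x + e n) t
      have h2 : |g (x + e n) t - g (x + e m) t| < η := htV
      have h3 := hD (x + e m) (y + e m) t
      have h4 := hD (y + e m) (y + e m + ∑ i ∈ B, e i) t
      rw [add_sub_cancel_left] at h1
      rw [add_sub_add_right_eq_sub] at h3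
      rw [sub_add_cancel_left, norm_neg] at h4
      have h5 := mul_le_mul_of_nonneg_left (hsum A hAr) hD0
      have h6 := mul_le_mul_of_nonneg_left (hsum B hBr) hD0
      have h7 : D * (‖x - y‖ + 2 * ((r + 1 : ℕ) : ℝ) - 2) = D * ‖x - y‖ + D * r + D * r := by
        push_cast; ring
      rw [h7]
      rw [abs_le] at *
      rw [abs_lt] at h2
      constructor <;> linarith
    · refine (h t ⟨ht, htV⟩).trans ?_
      have h1 : ‖x + e n - (y + e m)‖ ≤ ‖x - y‖ + 2 := by
        rw [add_sub_add_comm]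
        linarith [norm_add_le (x - y) (e n - e m), norm_sub_le (e n) (e m), he n, he m]
      have h2 : ‖x + e n - (y + e m)‖ + 2 * (r : ℝ) - 2
          ≤ ‖x - y‖ + 2 * ((r + 1 : ℕ) : ℝ) - 2 := by
        push_cast; linarith
      linarith [mul_le_mul_of_nonneg_left h2 hD0]

end Tree

/-- A map of finite distortion is bi-Lipschitz, with constants whose product is at most the
distortion. -/
lemma exists_lipschitz_consts {M : Type u} {N : Type v} [MetricSpace M] [MetricSpace N]
    {f : M → N} {C : ℝ} (hC : 0 ≤ C) (h : distortion f ≤ ENNReal.ofReal C) :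
    ∃ a b : ℝ, 0 ≤ a ∧ 0 ≤ b ∧ a * b ≤ C ∧ (∀ x y, dist (f x) (f y) ≤ a * dist x y) ∧
      ∀ x y, dist x y ≤ b * dist (f x) (f y) := by
  rcases subsingleton_or_nontrivial M with hM | hM
  · exact ⟨0, 0, le_rfl, le_rfl, by simpa using hC,
      fun x y => by simp [Subsingleton.elim x y], fun x y => by simp [Subsingleton.elim x y]⟩
  have hinj : Function.Injective f := by
    by_contra hn
    rw [distortion, if_neg hn] at h
    exact absurd h (by simp)
  rw [distortion, if_pos hinj] at h
  set A : ℝ≥0∞ := ⨆ (x : M) (y : M) (_ : x ≠ y), edist (f x) (f y) / edist x y with hA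
  set B : ℝ≥0∞ := ⨆ (x : M) (y : M) (_ : x ≠ y), edist x y / edist (f x) (f y) with hB
  have hAle : ∀ x y, x ≠ y → edist (f x) (f y) / edist x y ≤ A := fun x y hxy =>
    le_iSup_of_le x (le_iSup_of_le y (le_iSup_of_le hxy le_rfl))
  have hBle : ∀ x y, x ≠ y → edist x y / edist (f x) (f y) ≤ B := fun x y hxy =>
    le_iSup_of_le x (le_iSup_of_le y (le_iSup_of_le hxy le_rfl))
  obtain ⟨x₀, y₀, h₀⟩ := exists_pair_ne M
  have hA0 : A ≠ 0 := (lt_of_lt_of_le (ENNReal.div_pos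
    (edist_pos.2 (hinj.ne h₀)).ne' (edist_ne_top _ _)) (hAle x₀ y₀ h₀)).ne'
  have hB0 : B ≠ 0 := (lt_of_lt_of_le (ENNReal.div_pos
    (edist_pos.2 h₀).ne' (edist_ne_top _ _)) (hBle x₀ y₀ h₀)).ne'
  have hlt : A * B < ∞ := h.trans_lt ENNReal.ofReal_lt_top
  have hAt : A ≠ ∞ := fun hh => by rw [hh, ENNReal.top_mul hB0] at hlt; exact lt_irrefl _ hlt
  have hBt : B ≠ ∞ := fun hh => by rw [hh, ENNReal.mul_top hA0] at hlt; exact lt_irrefl _ hlt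
  refine ⟨A.toReal, B.toReal, ENNReal.toReal_nonneg, ENNReal.toReal_nonneg, ?_, ?_, ?_⟩
  · rw [← ENNReal.toReal_mul]
    exact ENNReal.toReal_le_of_le_ofReal hC h
  · intro x y
    rcases eq_or_ne x y with rfl | hxy
    · simp
    rw [dist_edist, dist_edist, ← ENNReal.toReal_mul]
    refine ENNReal.toReal_mono (ENNReal.mul_ne_top hAt (edist_ne_top _ _)) ?_
    exact (ENNReal.div_le_iff (edist_pos.2 hxy).ne' (edist_ne_top _ _)).1 (hAle x y hxy)
  · intro x y
    rcases eq_or_ne x y with rfl | hxy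
    · simp
    rw [dist_edist, dist_edist, ← ENNReal.toReal_mul]
    refine ENNReal.toReal_mono (ENNReal.mul_ne_top hBt (edist_ne_top _ _)) ?_
    exact (ENNReal.div_le_iff (edist_pos.2 (hinj.ne hxy)).ne' (edist_ne_top _ _)).1
      (hBle x y hxy)

/-- If sums of `k + 1` terms of a sequence in the unit ball with disjoint supports are as far apart
as possible, then the whole space is hard to embed into `C([0, ω ^ k])`. -/
lemma le_of_lipEmbeds {X : Type u} [NormedAddCommGroup X] {e : ℕ → X} (he : ∀ n, ‖e n‖ ≤ 1)
    {k : ℕ} (hk : 1 ≤ k) (hsep : ∀ A B : Finset ℕ, Disjoint A B → A.card = k + 1 →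
      B.card = k + 1 → 2 * ((k : ℝ) + 1) ≤ ‖∑ i ∈ A, e i - ∑ i ∈ B, e i‖)
    {C : ℝ} (hC : 0 ≤ C) (h : LipEmbeds X (COrdinal (Ordinal.omega0 ^ (k : Ordinal.{0}))) C) :
    ((k : ℝ) + 1) / k ≤ C := by
  obtain ⟨f, hf⟩ := h
  obtain ⟨a, b, ha, hb, hab, hfa, hfb⟩ := exists_lipschitz_consts hC hf
  have hk0 : (0 : ℝ) < k := by exact_mod_cast hk
  have h0 : (0 : Ordinal.{0}) ≤ Ordinal.omega0 ^ (k : Ordinal.{0}) := zero_le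
  -- Extending functions constantly to the right moves the argument to the space of all ordinals.
  let g : X → Ordinal.{0} → ℝ := fun x t => f x (Set.projIcc _ _ h0 t)
  have hg : ∀ x, Continuous (g x) := fun x => (f x).continuous.comp continuous_projIcc
  have hga : ∀ x y t, |g x t - g y t| ≤ a * ‖x - y‖ := fun x y t => by
    rw [← dist_eq_norm]
    exact (ContinuousMap.dist_apply_le_dist _).trans (hfa x y)
  have key : ∀ η : ℝ, 0 < η → 2 * ((k : ℝ) + 1) ≤ b * (a * (2 * k) + η) := by
    intro η hη
    obtain ⟨A, B, hAB, -, -, hA, hB, hle⟩ := exists_disjoint_sums he hg ha hga hη (k + 1) _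
      (hasRank_Icc_opow k) 0 0 ∅
    simp only [zero_add, sub_self, norm_zero] at hle
    refine (hsep A B hAB hA hB).trans ?_
    rw [← dist_eq_norm]
    refine (hfb _ _).trans (mul_le_mul_of_nonneg_left ?_ hb)
    have hpos : 0 ≤ a * (2 * k) + η := by positivity
    rw [ContinuousMap.dist_le hpos]
    intro t
    have h1 := hle t t.2
    simp only [g, Set.projIcc_val] at h1
    rw [Real.dist_eq]
    refine h1.trans (le_of_eq ?_)
    push_cast
    ring
  have hlim : 2 * ((k : ℝ) + 1) ≤ b * (a * (2 * k)) := by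
    refine le_of_forall_pos_le_add fun δ hδ => ?_
    refine (key (δ / (b + 1)) (by positivity)).trans ?_
    rw [mul_add]
    gcongr
    rw [← mul_div_assoc, div_le_iff₀ (by positivity)]
    nlinarith
  rw [div_le_iff₀ hk0]
  nlinarith

/-! ### A renorming of Hilbert space -/

section Renorming

variable {H : Type u} [NormedAddCommGroup H] [InnerProductSpace ℝ H]

open scoped RealInnerProductSpace BoundedContinuousFunction

/-- The vectors of norm at most `R` whose inner products with all `b n` are at most `1` in absolute
value. -/
def testVectors (b : ℕ → H) (R : ℝ) : Set H := {s | ‖s‖ ≤ R ∧ ∀ n, |⟪s, b n⟫| ≤ 1}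

/-- The map sending `x` to the family of its inner products with the test vectors. -/
noncomputable def testMap (b : ℕ → H) {R : ℝ} (hR : 0 ≤ R) :
    H →L[ℝ] (testVectors b R →ᵇ ℝ) :=
  have hbd (x : H) (s : testVectors b R) : ‖⟪(s : H), x⟫‖ ≤ R * ‖x‖ :=
    (norm_inner_le_norm _ _).trans (mul_le_mul_of_nonneg_right s.2.1 (norm_nonneg x))
  LinearMap.mkContinuous
    { toFun := fun x => BoundedContinuousFunction.ofNormedAddCommGroup
        (fun s : testVectors b R => ⟪(s : H), x⟫) (by fun_prop) (R * ‖x‖) (hbd x)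
      map_add' := fun x y => by ext s; simp [inner_add_right]
      map_smul' := fun c x => by ext s; simp [inner_smul_right] }
    R fun x => BoundedContinuousFunction.norm_ofNormedAddCommGroup_le _ (by positivity) (hbd x)

@[simp]
lemma testMap_apply (b : ℕ → H) {R : ℝ} (hR : 0 ≤ R) (x : H) (s : testVectors b R) :
    testMap b hR x s = ⟪(s : H), x⟫ := rfl

/-- The space `H` with the equivalent norm `max ‖x‖ (sup ⟪s, x⟫)`, the supremum being over the test
vectors `s`; it is encoded as the graph of `testMap`. -/
abbrev Renormed (b : ℕ → H) {R : ℝ} (hR : 0 ≤ R) : Type u :=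
  (testMap b hR : H →ₗ[ℝ] (testVectors b R →ᵇ ℝ)).graph

/-- The identity between the two norms. -/
noncomputable def renormedEquiv (b : ℕ → H) {R : ℝ} (hR : 0 ≤ R) : Renormed b hR ≃L[ℝ] H where
  toFun x := x.1.1
  invFun x := ⟨(x, testMap b hR x), rfl⟩
  map_add' _ _ := rfl
  map_smul' _ _ := rfl
  left_inv x := Subtype.ext (Prod.ext rfl x.2.symm)
  right_inv _ := rfl
  continuous_toFun := continuous_fst.comp continuous_subtype_val
  continuous_invFun := Continuous.subtype_mk
    (continuous_id.prodMk (testMap b hR).continuous) _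

lemma norm_renormedEquiv_symm (b : ℕ → H) {R : ℝ} (hR : 0 ≤ R) (x : H) :
    ‖(renormedEquiv b hR).symm x‖ = max ‖x‖ ‖testMap b hR x‖ := rfl

lemma norm_renormedEquiv_symm_le_one {b : ℕ → H} {R : ℝ} (hR : 0 ≤ R) {n : ℕ} (hb : ‖b n‖ ≤ 1) :
    ‖(renormedEquiv b hR).symm (b n)‖ ≤ 1 := by
  rw [norm_renormedEquiv_symm]
  exact max_le hb ((BoundedContinuousFunction.norm_le zero_le_one).2 fun s => s.2.2 n)

/-- The difference of the two sums is itself a test vector, so its inner product with itself bounds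
its new norm from below. -/
lemma card_add_card_le_norm_renormed {b : ℕ → H} (hb : Orthonormal ℝ b) {R : ℝ} (hR : 0 ≤ R)
    {A B : Finset ℕ} (hAB : Disjoint A B) (hcard : (A.card : ℝ) + B.card ≤ R) :
    (A.card : ℝ) + B.card ≤ ‖∑ i ∈ A, (renormedEquiv b hR).symm (b i)
      - ∑ i ∈ B, (renormedEquiv b hR).symm (b i)‖ := by
  set s : H := ∑ i ∈ A, b i - ∑ i ∈ B, b i with hs
  have hsb : ∀ n, ⟪s, b n⟫ = (if n ∈ A then 1 else 0) - (if n ∈ B then 1 else 0) := fun n => by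
    rw [hs, inner_sub_left, sum_inner, sum_inner]
    simp only [orthonormal_iff_ite.1 hb, Finset.sum_ite_eq']
  have hmem : s ∈ testVectors b R := by
    refine ⟨?_, fun n => ?_⟩
    · refine (norm_sub_le _ _).trans (le_trans ?_ hcard)
      have h1 : ∀ A : Finset ℕ, ‖∑ i ∈ A, b i‖ ≤ A.card := fun A =>
        (norm_sum_le _ _).trans (by simp [hb.1])
      exact add_le_add (h1 A) (h1 B)
    · rw [hsb]
      split_ifs <;> simp
  have hss : ⟪s, s⟫ = (A.card : ℝ) + B.card := by
    conv_lhs => rw [hs, inner_sub_right, inner_sum, inner_sum, ← hs]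
    simp only [hsb, Finset.sum_sub_distrib]
    rw [Finset.sum_ite_mem, Finset.sum_ite_mem, Finset.sum_ite_mem, Finset.sum_ite_mem,
      Finset.inter_self, Finset.inter_self, Finset.disjoint_iff_inter_eq_empty.1 hAB,
      Finset.disjoint_iff_inter_eq_empty.1 hAB.symm]
    simp
  rw [show ∑ i ∈ A, (renormedEquiv b hR).symm (b i) - ∑ i ∈ B, (renormedEquiv b hR).symm (b i)
    = (renormedEquiv b hR).symm s by simp only [hs, map_sub, map_sum], norm_renormedEquiv_symm]
  refine le_max_of_le_right ?_
  have h2 := (testMap b hR s).norm_coe_le_norm ⟨s, hmem⟩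
  rw [testMap_apply, hss] at h2
  exact (le_abs_self _).trans h2

end Renorming

/-! ### Spaces isomorphic to a Hilbert space -/

section Isomorphic

variable {H : Type v} [NormedAddCommGroup H] [InnerProductSpace ℝ H]

lemma sum_sign_norm_add_sq {n : ℕ} (x : Fin n → H) (v : H) :
    ∑ ε : Fin n → ℤˣ, ‖v + ∑ i, (ε i : ℤ) • x i‖ ^ 2 = 2 ^ n * (‖v‖ ^ 2 + ∑ i, ‖x i‖ ^ 2) := by
  induction n generalizing v with
  | zero => simp
  | succ n ih =>
    rw [← (Fin.consEquiv fun _ => ℤˣ).sum_comp, Fintype.sum_prod_type]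
    simp only [Fin.consEquiv_apply, Fin.sum_univ_succ, Fin.cons_zero, Fin.cons_succ, ← add_assoc,
      ih, UnitsInt.univ]
    rw [Finset.sum_pair (by decide)]
    have := parallelogram_law_with_norm ℝ v (x 0)
    simp only [Units.val_one, one_smul, Units.val_neg, neg_smul, ← sub_eq_add_neg]
    rw [pow_succ]
    linear_combination 2 ^ n * this

lemma rademacherMean_two {n : ℕ} (x : Fin n → H) : rademacherMean 2 x = ∑ i, ‖x i‖ ^ (2 : ℝ) := by
  have h := sum_sign_norm_add_sq x 0
  simp only [zero_add, norm_zero] at h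
  simp only [rademacherMean, Real.rpow_two, h]
  field_simp
  ring

variable {X : Type u} [NormedAddCommGroup X] [NormedSpace ℝ X]

lemma rademacherMean_le_of_map {Y : Type v} [NormedAddCommGroup Y] [NormedSpace ℝ Y]
    (T : X →L[ℝ] Y) {n : ℕ} (x : Fin n → X) :
    rademacherMean 2 (fun i => T (x i)) ≤ ‖T‖ ^ 2 * rademacherMean 2 x := by
  simp only [rademacherMean, ← mul_div_assoc, Finset.mul_sum, Real.rpow_two, ← mul_pow]
  gcongr with ε
  have h : ∑ i, (ε i : ℤ) • T (x i) = T (∑ i, (ε i : ℤ) • x i) := by simp [map_sum]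
  rw [h]
  exact T.le_opNorm _

lemma sum_norm_sq_le_of_map {Y : Type v} [NormedAddCommGroup Y] [NormedSpace ℝ Y]
    (T : X →L[ℝ] Y) {n : ℕ} (x : Fin n → X) :
    ∑ i, ‖T (x i)‖ ^ (2 : ℝ) ≤ ‖T‖ ^ 2 * ∑ i, ‖x i‖ ^ (2 : ℝ) := by
  simp only [Finset.mul_sum, Real.rpow_two, ← mul_pow]
  gcongr with i
  exact T.le_opNorm _

lemma rpow_half_le {a b c : ℝ} (hc : 0 ≤ c) (h : a ≤ c ^ 2 * b) :
    a ^ (1 / 2 : ℝ) ≤ c * b ^ (1 / 2 : ℝ) := by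
  rw [← Real.sqrt_eq_rpow, ← Real.sqrt_eq_rpow]
  refine (Real.sqrt_le_sqrt h).trans (le_of_eq ?_)
  rw [Real.sqrt_mul (sq_nonneg c), Real.sqrt_sq hc]

lemma hasType_two (e : X ≃L[ℝ] H) : HasType X 2 := by
  refine ⟨‖(e.symm : H →L[ℝ] X)‖ * ‖(e : X →L[ℝ] H)‖, fun n x => ?_⟩
  refine rpow_half_le (by positivity) ?_
  have h1 := rademacherMean_le_of_map (e.symm : H →L[ℝ] X) fun i => e (x i)
  have h2 := sum_norm_sq_le_of_map (e : X →L[ℝ] H) x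
  simp only [ContinuousLinearEquiv.coe_coe, ContinuousLinearEquiv.symm_apply_apply,
    rademacherMean_two] at h1 h2
  rw [mul_pow, mul_assoc]
  exact h1.trans (by gcongr)

lemma hasCotype_two (e : X ≃L[ℝ] H) : HasCotype X 2 := by
  refine ⟨‖(e.symm : H →L[ℝ] X)‖ * ‖(e : X →L[ℝ] H)‖, fun n x => ?_⟩
  refine rpow_half_le (by positivity) ?_
  have h1 := rademacherMean_le_of_map (e : X →L[ℝ] H) x
  have h2 := sum_norm_sq_le_of_map (e.symm : H →L[ℝ] X) fun i => e (x i)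
  simp only [ContinuousLinearEquiv.coe_coe, ContinuousLinearEquiv.symm_apply_apply,
    rademacherMean_two] at h1 h2
  rw [mul_pow, mul_assoc]
  exact h2.trans (by gcongr)

lemma isReflexiveSpace_of_equiv [CompleteSpace H] (e : X ≃L[ℝ] H) : IsReflexiveSpace X := by
  intro φ
  -- The functional `h ↦ φ ⟪h, e ·⟫` on `H` is represented by a vector, which is the preimage.
  let Φ : H →L[ℝ] StrongDual ℝ X :=
    ((ContinuousLinearMap.compL ℝ X H ℝ).flip (e : X →L[ℝ] H)).comp (innerSL ℝ)
  obtain ⟨y, hy⟩ := (InnerProductSpace.toDual ℝ H).surjective (φ.comp Φ)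
  refine ⟨e.symm y, ?_⟩
  ext f
  obtain ⟨h, hh⟩ := (InnerProductSpace.toDual ℝ H).surjective (f.comp (e.symm : H →L[ℝ] X))
  have hf : Φ h = f := by
    ext x
    have := DFunLike.congr_fun hh (e x)
    simpa [Φ] using this
  have h1 := DFunLike.congr_fun hy h
  have h2 := DFunLike.congr_fun hh y
  simp only [InnerProductSpace.toDual_apply_apply, ContinuousLinearMap.comp_apply, hf,
    ContinuousLinearEquiv.coe_coe] at h1 h2
  rw [NormedSpace.dual_def, ← h2, ← h1, real_inner_comm]

end Isomorphic

/-- Every class in question contains a space isomorphic to a Hilbert space in which disjoint sums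
of basis vectors are as far apart as the triangle inequality allows. -/
lemma exists_mem_class (F : Set MetSp.{u})
    (hF : F = separableMetric ∨ F = separableBanach ∨ F = separableCotype ∨ F = separableType ∨
      F = separableReflexive) (k : ℕ) :
    ∃ (X : Type u) (_ : NormedAddCommGroup X) (e : ℕ → X), MetSp.mk X ∈ F ∧ (∀ n, ‖e n‖ ≤ 1) ∧
      ∀ A B : Finset ℕ, Disjoint A B → A.card = k + 1 → B.card = k + 1 →
        2 * ((k : ℝ) + 1) ≤ ‖∑ i ∈ A, e i - ∑ i ∈ B, e i‖ := by
  let β : HilbertBasis (ULift.{u} ℕ) ℝ (lp (fun _ : ULift.{u} ℕ => ℝ) 2) := default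
  have hR : (0 : ℝ) ≤ 2 * (k + 1) := by positivity
  let b : ℕ → lp (fun _ : ULift.{u} ℕ => ℝ) 2 := fun n => β ⟨n⟩
  have hb : Orthonormal ℝ b := β.orthonormal.comp _ fun _ _ h => congrArg ULift.down h
  let j := renormedEquiv b hR
  have hsepH : TopologicalSpace.SeparableSpace (lp (fun _ : ULift.{u} ℕ => ℝ) 2) := by
    rw [← TopologicalSpace.isSeparable_univ_iff]
    have h1 := ((Set.countable_range β).isSeparable.span (R := ℝ)).closure
    rwa [← Submodule.topologicalClosure_coe, β.dense_span] at h1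
  have hsep : TopologicalSpace.SeparableSpace (Renormed b hR) :=
    j.symm.surjective.denseRange.separableSpace j.symm.continuous
  have hcomp : CompleteSpace (Renormed b hR) :=
    (isClosed_eq continuous_snd ((testMap b hR).continuous.comp continuous_fst)).completeSpace_coe
  refine ⟨Renormed b hR, inferInstance, fun n => j.symm (b n), ?_,
    fun n => norm_renormedEquiv_symm_le_one hR (hb.1 n).le, fun A B hAB hA hB => ?_⟩
  · rcases hF with rfl | rfl | rfl | rfl | rfl
    · exact hsep
    · exact ⟨Renormed b hR, inferInstance, inferInstance, hcomp, hsep, trivial, rfl⟩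
    · exact ⟨Renormed b hR, inferInstance, inferInstance, hcomp, hsep,
        ⟨2, le_rfl, hasCotype_two j⟩, rfl⟩
    · exact ⟨Renormed b hR, inferInstance, inferInstance, hcomp, hsep,
        ⟨2, one_lt_two, le_rfl, hasType_two j⟩, rfl⟩
    · exact ⟨Renormed b hR, inferInstance, inferInstance, hcomp, hsep,
        isReflexiveSpace_of_equiv j, rfl⟩
  · have hc : (A.card : ℝ) + B.card = 2 * (k + 1) := by
      rw [hA, hB]; push_cast; ring
    have h1 := card_add_card_le_norm_renormed hb hR hAB hc.le
    rwa [hc] at h1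

lemma le_classDistortion (F : Set MetSp.{u})
    (hF : F = separableMetric ∨ F = separableBanach ∨ F = separableCotype ∨ F = separableType ∨
      F = separableReflexive) (k : ℕ) (hk : 1 ≤ k) :
    ((k : ℝ≥0∞) + 1) / (k : ℝ≥0∞) ≤
      classDistortion (COrdinal (Ordinal.omega0 ^ (k : Ordinal.{0}))) F := by
  obtain ⟨X, _, e, hX, he, hsep⟩ := exists_mem_class F hF k
  refine le_iSup₂_of_le (MetSp.mk X) hX (le_iInf fun C => le_iInf fun hC => le_iInf fun h => ?_)
  have hk0 : (0 : ℝ) < k := by exact_mod_cast hk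
  have h1 := ENNReal.ofReal_le_ofReal (le_of_lipEmbeds he hk hsep (zero_le_one.trans hC) h)
  rwa [ENNReal.ofReal_div_of_pos hk0, ENNReal.ofReal_add hk0.le zero_le_one,
    ENNReal.ofReal_natCast, ENNReal.ofReal_one] at h1

/-! ### Lipschitz functions that separate two sets -/

section SepFun

variable {M : Type u} [MetricSpace M]

/-- For sets `U`, `V` at distance at least `s + t`, a `1`-Lipschitz function that is at least `s` on
`U`, at most `-t` on `V`, and zero away from both. -/
noncomputable def sepFun (s t : ℝ) (U V : Set M) (z : M) : ℝ :=
  max 0 (s - Metric.infDist z U) - max 0 (t - Metric.infDist z V)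

variable {s t : ℝ} {U V : Set M}

lemma add_le_infDist_add (hU : U.Nonempty) (hV : V.Nonempty)
    (h : ∀ u ∈ U, ∀ v ∈ V, s + t ≤ dist u v) (z w : M) :
    s + t ≤ Metric.infDist z U + dist z w + Metric.infDist w V := by
  have h1 : s + t - dist z w - Metric.infDist w V ≤ Metric.infDist z U := by
    rw [Metric.le_infDist hU]
    intro u hu
    have h2 : s + t - dist z w - dist z u ≤ Metric.infDist w V := by
      rw [Metric.le_infDist hV]
      intro v hv
      linarith [h u hu v hv, dist_triangle4 u z w v, dist_comm u z]
    linarith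
  linarith

lemma sepFun_sub_le (hU : U.Nonempty) (hV : V.Nonempty)
    (h : ∀ u ∈ U, ∀ v ∈ V, s + t ≤ dist u v) (z w : M) :
    sepFun s t U V z - sepFun s t U V w ≤ dist z w := by
  have h1 : Metric.infDist w U ≤ Metric.infDist z U + dist w z :=
    Metric.infDist_le_infDist_add_dist
  have h2 : Metric.infDist z V ≤ Metric.infDist w V + dist z w :=
    Metric.infDist_le_infDist_add_dist
  have h3 := add_le_infDist_add hU hV h z w
  have h4 : 0 ≤ dist z w := dist_nonneg
  rw [dist_comm w z] at h1
  unfold sepFun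
  rcases max_cases 0 (s - Metric.infDist z U) with ⟨e1, _⟩ | ⟨e1, _⟩ <;>
  rcases max_cases 0 (t - Metric.infDist z V) with ⟨e2, _⟩ | ⟨e2, _⟩ <;>
  rcases max_cases 0 (s - Metric.infDist w U) with ⟨e3, _⟩ | ⟨e3, _⟩ <;>
  rcases max_cases 0 (t - Metric.infDist w V) with ⟨e4, _⟩ | ⟨e4, _⟩ <;>
  rw [e1, e2, e3, e4] <;> linarith

lemma le_sepFun (hV : V.Nonempty) (h : ∀ u ∈ U, ∀ v ∈ V, s + t ≤ dist u v) {z : M} (hz : z ∈ U) :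
    s ≤ sepFun s t U V z := by
  have h1 : s + t ≤ Metric.infDist z V := (Metric.le_infDist hV).2 fun v hv => h z hz v hv
  rw [sepFun, Metric.infDist_zero_of_mem hz]
  rcases max_cases 0 (s - 0) with ⟨e1, _⟩ | ⟨e1, _⟩ <;>
  rcases max_cases 0 (t - Metric.infDist z V) with ⟨e2, _⟩ | ⟨e2, _⟩ <;>
  rw [e1, e2] <;> linarith

lemma sepFun_swap (z : M) : sepFun t s V U z = -sepFun s t U V z := by
  simp [sepFun]

lemma sepFun_eq_zero (hU : U.Nonempty) (hV : V.Nonempty) {z : M} (hzU : ∀ u ∈ U, s ≤ dist u z)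
    (hzV : ∀ v ∈ V, t ≤ dist v z) : sepFun s t U V z = 0 := by
  have h1 : s ≤ Metric.infDist z U :=
    (Metric.le_infDist hU).2 fun u hu => by rw [dist_comm]; exact hzU u hu
  have h2 : t ≤ Metric.infDist z V :=
    (Metric.le_infDist hV).2 fun v hv => by rw [dist_comm]; exact hzV v hv
  rw [sepFun, max_eq_left (by linarith), max_eq_left (by linarith), sub_zero]

lemma abs_sepFun_le {ρ : ℝ} (hρ : 0 ≤ ρ) (hs : s ≤ ρ) (ht : t ≤ ρ) (z : M) :
    |sepFun s t U V z| ≤ ρ := by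
  have h1 : max 0 (s - Metric.infDist z U) ≤ ρ :=
    max_le hρ (by linarith [Metric.infDist_nonneg (x := z) (s := U)])
  have h2 : max 0 (t - Metric.infDist z V) ≤ ρ :=
    max_le hρ (by linarith [Metric.infDist_nonneg (x := z) (s := V)])
  rw [sepFun, abs_le]
  constructor <;> linarith [le_max_left 0 (s - Metric.infDist z U),
    le_max_left 0 (t - Metric.infDist z V)]

end SepFun

/-! ### The coordinate functions of an embedding into `c₀` -/

section Coordinates

variable {M : Type u} [MetricSpace M]

/-- The pairs of points at distance about `ρ` for which `x n`, near the first point, is the first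
term of the dense sequence that comes too close. Here `t` is, up to an error `ε * ρ`, the distance
from the second point to `{x m | m < n}`, attained at `x i`. -/
def pairSet (x : ℕ → M) (ε ρ t : ℝ) (n i : ℕ) : Set (M × M) :=
  {p | ρ ≤ dist p.1 p.2 ∧ i < n ∧ t ≤ ρ ∧ (∀ m < n, (1 / 2 - 3 / 2 * ε) * ρ - t ≤ dist p.1 (x m)) ∧
    (∀ m < n, t ≤ dist p.2 (x m)) ∧ dist p.1 (x n) ≤ (1 + ε) / 2 * ρ - t ∧
    dist p.2 (x i) ≤ t + ε * ρ}

lemma le_dist_of_mem_pairSet {x : ℕ → M} {ε ρ t : ℝ} {n i : ℕ} {p q : M × M}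
    (hp : p ∈ pairSet x ε ρ t n i) (hq : q ∈ pairSet x ε ρ t n i) :
    (1 / 2 - 3 / 2 * ε) * ρ ≤ dist p.1 q.2 := by
  obtain ⟨hp1, -, -, -, -, hp2, hp3⟩ := hp
  obtain ⟨hq1, -, -, -, -, hq2, hq3⟩ := hq
  -- Changing one point of either pair costs the diameter of one ball; the two costs add up to
  -- about `ρ`, so the cheaper change costs only half of it.
  have h1 : dist p.1 p.2 ≤ dist p.1 q.2 + (dist q.2 (x i) + dist (x i) p.2) :=
    (dist_triangle _ q.2 _).trans (by gcongr; exact dist_triangle _ _ _)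
  have h2 : dist q.1 q.2 ≤ dist q.1 (x n) + dist (x n) p.1 + dist p.1 q.2 :=
    (dist_triangle _ p.1 _).trans (by gcongr; exact dist_triangle _ _ _)
  rw [dist_comm (x i)] at h1
  rw [dist_comm (x n)] at h2
  linarith

lemma le_dist_of_pairSet_nonempty {x : ℕ → M} {ε ρ t : ℝ} {n i : ℕ}
    (h : (pairSet x ε ρ t n i).Nonempty) : (1 / 2 - 3 / 2 * ε) * ρ ≤ dist (x n) (x i) := by
  obtain ⟨p, hp1, -, -, -, -, hp2, hp3⟩ := h
  have h1 := dist_triangle4 p.1 (x n) (x i) p.2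
  rw [dist_comm (x i)] at h1
  linarith

open Classical in
/-- The coordinate functions of the embedding, indexed by the scale `ρ = (1 + ε) ^ a`, the
positions `n` and `i`, and the multiple `t = l * (ε * ρ)`. The case distinction is needed because
`Metric.infDist` to the empty set is zero. -/
noncomputable def coord (x : ℕ → M) (ε : ℝ) (j : ℤ × ℕ × ℕ × ℕ) (z : M) : ℝ :=
  let ρ : ℝ := (1 + ε) ^ j.1
  let t : ℝ := j.2.2.2 * (ε * ρ)
  let P := pairSet x ε ρ t j.2.1 j.2.2.1
  if P.Nonempty then
    sepFun ((1 / 2 - 3 / 2 * ε) * ρ - t) t (Prod.fst '' P) (Prod.snd '' P) z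
  else 0

lemma coord_of_nonempty {x : ℕ → M} {ε : ℝ} {a : ℤ} {n i l : ℕ} {ρ t : ℝ}
    (hρ : ρ = (1 + ε) ^ a) (ht : t = l * (ε * ρ)) (h : (pairSet x ε ρ t n i).Nonempty) (z : M) :
    coord x ε (a, n, i, l) z = sepFun ((1 / 2 - 3 / 2 * ε) * ρ - t) t
      (Prod.fst '' pairSet x ε ρ t n i) (Prod.snd '' pairSet x ε ρ t n i) z := by
  subst ht hρ
  exact if_pos h

lemma coord_of_empty {x : ℕ → M} {ε : ℝ} {a : ℤ} {n i l : ℕ} {ρ t : ℝ}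
    (hρ : ρ = (1 + ε) ^ a) (ht : t = l * (ε * ρ)) (h : ¬(pairSet x ε ρ t n i).Nonempty) (z : M) :
    coord x ε (a, n, i, l) z = 0 := by
  subst ht hρ
  exact if_neg h

lemma forall_image_le_dist {x : ℕ → M} {ε ρ t : ℝ} {n i : ℕ} :
    ∀ u ∈ Prod.fst '' pairSet x ε ρ t n i, ∀ v ∈ Prod.snd '' pairSet x ε ρ t n i,
      (1 / 2 - 3 / 2 * ε) * ρ - t + t ≤ dist u v := by
  rintro _ ⟨p, hp, rfl⟩ _ ⟨q, hq, rfl⟩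
  rw [sub_add_cancel]
  exact le_dist_of_mem_pairSet hp hq

lemma abs_coord_sub_le (x : ℕ → M) (ε : ℝ) (j : ℤ × ℕ × ℕ × ℕ) (z w : M) :
    |coord x ε j z - coord x ε j w| ≤ dist z w := by
  obtain ⟨a, n, i, l⟩ := j
  by_cases h : (pairSet x ε ((1 + ε) ^ a) (l * (ε * (1 + ε) ^ a)) n i).Nonempty
  · rw [coord_of_nonempty rfl rfl h, coord_of_nonempty rfl rfl h, abs_sub_le_iff]
    have h1 := sepFun_sub_le (h.image Prod.fst) (h.image Prod.snd) forall_image_le_dist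
    exact ⟨h1 z w, by rw [dist_comm]; exact h1 w z⟩
  · rw [coord_of_empty rfl rfl h, coord_of_empty rfl rfl h]
    simp

/-- All coordinates of a point but finitely many are small: if `x m` is close to the point, then
the coordinates with `m < n` are small, those with `n ≤ m` vanish at large scales, and small scales
have small values. -/
lemma finite_lt_abs_coord {x : ℕ → M} (hx : DenseRange x) {ε : ℝ} (hε : 0 < ε) (hε' : 3 * ε < 1)
    (z : M) {η : ℝ} (hη : 0 < η) : {j | η < |coord x ε j z|}.Finite := by
  obtain ⟨m, hm⟩ := hx.exists_dist_lt z hη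
  have h1ε : 1 < 1 + ε := by linarith
  have hκ : 0 < 1 / 2 - 3 / 2 * ε := by linarith
  obtain ⟨A, hA, -⟩ := exists_mem_Ico_zpow hη h1ε
  set R : ℝ := Metric.diam (x '' Set.Iic m) with hR
  have hR0 : 0 ≤ R := Metric.diam_nonneg
  obtain ⟨B, -, hB⟩ := exists_mem_Ico_zpow
    (show 0 < R / (1 / 2 - 3 / 2 * ε) + 1 by positivity) h1ε
  obtain ⟨L, hL⟩ := exists_nat_ge (1 / ε)
  refine ((Set.finite_Icc A (B + 1)).prod ((Set.finite_Iic m).prod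
    ((Set.finite_Iic m).prod (Set.finite_Iic L)))).subset ?_
  rintro ⟨a, n, i, l⟩ hj
  simp only [Set.mem_ofPred_eq] at hj
  set ρ : ℝ := (1 + ε) ^ a with hρ
  set t : ℝ := l * (ε * ρ) with ht
  have hρ0 : 0 < ρ := zpow_pos (by linarith) a
  have h : (pairSet x ε ρ t n i).Nonempty := by
    by_contra h
    rw [coord_of_empty hρ ht h, abs_zero] at hj
    exact absurd hj (not_lt.2 hη.le)
  have hdist := le_dist_of_pairSet_nonempty h
  obtain ⟨-, -, hi, htρ, -⟩ := id h
  have hnm : n ≤ m := by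
    by_contra hnm
    have h0 : coord x ε (a, n, i, l) (x m) = 0 := by
      rw [coord_of_nonempty hρ ht h]
      refine sepFun_eq_zero (h.image _) (h.image _) ?_ ?_
      · rintro _ ⟨p, hp, rfl⟩
        exact hp.2.2.2.1 m (not_le.1 hnm)
      · rintro _ ⟨p, hp, rfl⟩
        exact hp.2.2.2.2.1 m (not_le.1 hnm)
    have h1 := abs_coord_sub_le x ε (a, n, i, l) z (x m)
    rw [h0, sub_zero] at h1
    linarith
  have hηρ : η < ρ := by
    rw [coord_of_nonempty hρ ht h] at hj
    refine hj.trans_le (abs_sepFun_le hρ0.le ?_ htρ z)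
    have : 0 ≤ t := by positivity
    nlinarith
  have hρR : ρ < (1 + ε) ^ (B + 1) := by
    have h1 : dist (x n) (x i) ≤ R := Metric.dist_le_diam_of_mem
      ((Set.finite_Iic m).image x).isBounded (Set.mem_image_of_mem x hnm)
      (Set.mem_image_of_mem x (hi.le.trans hnm))
    have h2 : ρ ≤ R / (1 / 2 - 3 / 2 * ε) := by
      rw [le_div_iff₀ hκ]
      linarith
    linarith
  have hl : l ≤ L := by
    have h1 : (l : ℝ) * ε ≤ 1 := by
      rw [ht, ← mul_assoc] at htρ
      nlinarith
    have h2 : (l : ℝ) ≤ L := ((le_div_iff₀ hε).2 h1).trans hL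
    exact_mod_cast h2
  exact ⟨⟨((zpow_lt_zpow_iff_right₀ h1ε).1 (hA.trans_lt hηρ)).le,
    ((zpow_lt_zpow_iff_right₀ h1ε).1 hρR).le⟩, hnm, hi.le.trans hnm, hl⟩

/-- The separating coordinate has the scale just below `dist p q` and the multiple of `ε * ρ` just
below `dist q (x i)`; these roundings cause the loss of a factor close to one. -/
lemma exists_le_abs_coord_sub_of_forall {x : ℕ → M} {ε : ℝ} (hε : 0 < ε) (hε' : 3 * ε < 1)
    {p q : M} (hpq : p ≠ q) {n i : ℕ} (hi : i < n)
    (hlt : dist p (x n) + dist q (x i) < dist p q / 2)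
    (hle : ∀ m < n, dist p q / 2 ≤ dist p (x m) + dist q (x i))
    (hmin : ∀ m < n, dist q (x i) ≤ dist q (x m)) :
    ∃ j, (1 / 2 - 3 / 2 * ε) / (1 + ε) * dist p q ≤ |coord x ε j p - coord x ε j q| := by
  have h1ε : 1 < 1 + ε := by linarith
  obtain ⟨a, ha, ha'⟩ := exists_mem_Ico_zpow (dist_pos.2 hpq) h1ε
  rw [zpow_add_one₀ (by linarith)] at ha'
  set ρ : ℝ := (1 + ε) ^ a with hρ
  have hρ0 : 0 < ρ := zpow_pos (by linarith) a
  have hερ : 0 < ε * ρ := mul_pos hε hρ0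
  have hl := Nat.floor_le (div_nonneg (dist_nonneg (x := q) (y := x i)) hερ.le)
  have hl' := (Nat.lt_floor_add_one (dist q (x i) / (ε * ρ))).le
  set l : ℕ := ⌊dist q (x i) / (ε * ρ)⌋₊
  rw [le_div_iff₀ hερ] at hl
  rw [div_le_iff₀ hερ, add_mul, one_mul] at hl'
  set t : ℝ := l * (ε * ρ) with ht
  have hpnn : 0 ≤ dist p (x n) := dist_nonneg
  have hmem : (p, q) ∈ pairSet x ε ρ t n i := by
    refine ⟨ha, hi, ?_, fun m hm => ?_, fun m hm => hl.trans (hmin m hm), ?_, hl'⟩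
    · nlinarith
    · have := hle m hm
      simp only
      linarith
    · simp only
      linarith
  have hne : (pairSet x ε ρ t n i).Nonempty := ⟨_, hmem⟩
  refine ⟨(a, n, i, l), ?_⟩
  rw [coord_of_nonempty hρ ht hne, coord_of_nonempty hρ ht hne]
  have h1 := le_sepFun (hne.image Prod.snd) forall_image_le_dist (Set.mem_image_of_mem Prod.fst hmem)
  have h2 := le_sepFun (s := t) (t := (1 / 2 - 3 / 2 * ε) * ρ - t) (hne.image Prod.fst)
    (fun u hu v hv => by
      rw [add_comm, dist_comm]
      exact forall_image_le_dist v hv u hu) (Set.mem_image_of_mem Prod.snd hmem)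
  rw [sepFun_swap] at h2
  refine le_trans ?_ (le_abs_self _)
  have h3 : (1 / 2 - 3 / 2 * ε) / (1 + ε) * dist p q ≤ (1 / 2 - 3 / 2 * ε) * ρ := by
    rw [div_mul_eq_mul_div, div_le_iff₀ (by linarith), mul_assoc]
    exact mul_le_mul_of_nonneg_left ha'.le (by linarith)
  simp only at h1 h2
  linarith

/-- Every pair of points is separated by a coordinate. The sum of the distances of the two points
from `{x m | m < n}` is at least half their distance at first and tends to zero; the coordinate
corresponds to the first `n` that brings it below one half. -/
lemma exists_le_abs_coord_sub {x : ℕ → M} (hx : DenseRange x) {ε : ℝ} (hε : 0 < ε)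
    (hε' : 3 * ε < 1) {p q : M} (hpq : p ≠ q) :
    ∃ j, (1 / 2 - 3 / 2 * ε) / (1 + ε) * dist p q ≤ |coord x ε j p - coord x ε j q| := by
  have hd : 0 < dist p q := dist_pos.2 hpq
  have hex : ∃ n, ∃ i ≤ n, ∃ j ≤ n, dist p (x i) + dist q (x j) < dist p q / 2 := by
    obtain ⟨i, hi⟩ := hx.exists_dist_lt p (show 0 < dist p q / 4 by linarith)
    obtain ⟨j, hj⟩ := hx.exists_dist_lt q (show 0 < dist p q / 4 by linarith)
    exact ⟨max i j, i, le_max_left _ _, j, le_max_right _ _, by linarith⟩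
  classical
  obtain ⟨i, hi, j, hj, hij⟩ := Nat.find_spec hex
  set n := Nat.find hex
  have hbelow : ∀ i < n, ∀ j < n, dist p q / 2 ≤ dist p (x i) + dist q (x j) := by
    intro i hi j hj
    by_contra hlt
    exact Nat.find_min hex (max_lt hi hj)
      ⟨i, le_max_left _ _, j, le_max_right _ _, not_le.1 hlt⟩
  have hne : i ≠ j := by
    rintro rfl
    linarith [dist_triangle_right p q (x i)]
  have hmin : ∀ y : M, 0 < n → ∃ i < n, ∀ m < n, dist y (x i) ≤ dist y (x m) := by
    intro y hn
    obtain ⟨i, hi, h⟩ := Finset.exists_min_image (Finset.range n) (fun m => dist y (x m))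
      ⟨0, Finset.mem_range.2 hn⟩
    exact ⟨i, Finset.mem_range.1 hi, fun m hm => h m (Finset.mem_range.2 hm)⟩
  have hor : (i = n ∧ j < n) ∨ (j = n ∧ i < n) := by
    rcases hi.lt_or_eq with h1 | h1
    · rcases hj.lt_or_eq with h2 | h2
      · exact absurd hij (not_lt.2 (hbelow i h1 j h2))
      · exact Or.inr ⟨h2, h1⟩
    · exact Or.inl ⟨h1, lt_of_le_of_ne hj fun h2 => hne (h1.trans h2.symm)⟩
  rcases hor with ⟨hin, hjn⟩ | ⟨hjn, hin⟩
  · obtain ⟨i', hi', h⟩ := hmin q (Nat.zero_lt_of_lt hjn)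
    rw [hin] at hij
    exact exists_le_abs_coord_sub_of_forall hε hε' hpq hi' (by linarith [h j hjn])
      (fun m hm => hbelow m hm i' hi') h
  · obtain ⟨i', hi', h⟩ := hmin p (Nat.zero_lt_of_lt hin)
    rw [hjn] at hij
    obtain ⟨j, hj⟩ := exists_le_abs_coord_sub_of_forall hε hε' hpq.symm hi'
      (by rw [dist_comm q p]; linarith [h i hin])
      (fun m hm => by rw [dist_comm q p, add_comm]; exact hbelow i' hi' m hm) h
    exact ⟨j, by rwa [dist_comm p q, abs_sub_comm]⟩

end Coordinates

/-! ### The upper bound -/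

lemma distortion_le {M : Type u} {N : Type v} [MetricSpace M] [MetricSpace N] {f : M → N} {C : ℝ}
    (h1 : ∀ x y, dist (f x) (f y) ≤ dist x y)
    (h2 : ∀ x y, dist x y ≤ C * dist (f x) (f y)) : distortion f ≤ ENNReal.ofReal C := by
  have hinj : Function.Injective f := fun x y hxy => by
    have := h2 x y
    rw [hxy, dist_self, mul_zero] at this
    exact dist_le_zero.1 this
  rw [distortion, if_pos hinj, ← one_mul (ENNReal.ofReal C)]
  refine mul_le_mul' (iSup_le fun x => iSup_le fun y => iSup_le fun hxy => ?_)
    (iSup_le fun x => iSup_le fun y => iSup_le fun hxy => ?_)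
  · refine ENNReal.div_le_of_le_mul ?_
    rw [one_mul, edist_dist, edist_dist]
    exact ENNReal.ofReal_le_ofReal (h1 x y)
  · refine ENNReal.div_le_of_le_mul ?_
    rw [edist_dist, edist_dist, ← ENNReal.ofReal_mul' dist_nonneg]
    exact ENNReal.ofReal_le_ofReal (h2 x y)

/-- A family tending to zero, placed at finite ordinals and extended by zero, is continuous on the
ordinals. -/
lemma continuous_extend_of_finite {ι : Type*} {c : ι → ℕ} (hc : Function.Injective c) {a : ι → ℝ}
    (ha : ∀ η : ℝ, 0 < η → {i | η < |a i|}.Finite) :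
    Continuous (Function.extend (fun i => ((c i : ℕ) : Ordinal.{u})) a 0) := by
  set j : ι → Ordinal.{u} := fun i => ((c i : ℕ) : Ordinal.{u}) with hj
  have hinj : Function.Injective j := fun i i' h => hc (Nat.cast_injective h)
  rw [continuous_iff_continuousAt]
  intro t
  by_cases ht : Order.IsSuccLimit t
  · have hval : Function.extend j a 0 t = 0 := by
      refine Function.extend_apply' _ _ _ ?_
      rintro ⟨i, rfl⟩
      exact Ordinal.natCast_lt_omega0 (c i) |>.not_ge (Ordinal.omega0_le_of_isSuccLimit ht)
    rw [ContinuousAt, hval, Metric.tendsto_nhds]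
    intro η hη
    have hfin := (ha (η / 2) (by positivity)).image j
    have hsub : {s | ¬dist (Function.extend j a 0 s) 0 < η} ⊆ j '' {i | η / 2 < |a i|} := by
      intro s hs
      by_cases h : ∃ i, j i = s
      · obtain ⟨i, rfl⟩ := h
        refine Set.mem_image_of_mem j ?_
        simp only [Set.mem_ofPred_eq, hinj.extend_apply, Real.dist_eq, sub_zero, not_lt] at hs ⊢
        linarith
      · rw [Set.mem_ofPred_eq, Function.extend_apply' _ _ _ h] at hs
        simp [hη] at hs
    have htn : t ∉ j '' {i | η / 2 < |a i|} := by
      rintro ⟨i, -, rfl⟩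
      exact Ordinal.natCast_lt_omega0 (c i) |>.not_ge (Ordinal.omega0_le_of_isSuccLimit ht)
    filter_upwards [hfin.isClosed.isOpen_compl.mem_nhds htn] with s hs
    by_contra hs'
    exact hs (hsub hs')
  · rw [ContinuousAt, SuccOrder.nhds_eq_pure.2 ht]
    exact tendsto_pure_nhds _ _

lemma lipEmbeds_of_two_lt {M : Type u} [MetricSpace M] [TopologicalSpace.SeparableSpace M] {C : ℝ}
    (hC : 2 < C) {k : ℕ} (hk : 1 ≤ k) :
    LipEmbeds M (COrdinal (Ordinal.omega0 ^ (k : Ordinal.{0}))) C := by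
  rcases isEmpty_or_nonempty M with hM | hM
  · exact ⟨fun _ => 0, distortion_le (fun x => hM.elim x) fun x => hM.elim x⟩
  let x := TopologicalSpace.denseSeq M
  have hx : DenseRange x := TopologicalSpace.denseRange_denseSeq M
  -- This `ε` solves `1 + ε = C * (1 / 2 - 3 / 2 * ε)`.
  obtain ⟨ε, hε, hε', hεC⟩ : ∃ ε : ℝ, 0 < ε ∧ 3 * ε < 1 ∧ 1 + ε = C * (1 / 2 - 3 / 2 * ε) := by
    have h0 : (0 : ℝ) < 2 + 3 * C := by linarith
    refine ⟨(C - 2) / (2 + 3 * C), div_pos (by linarith) h0, ?_, ?_⟩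
    · rw [← mul_div_assoc, div_lt_one h0]
      linarith
    · field_simp
      ring
  let c : ℤ × ℕ × ℕ × ℕ → ℕ := Encodable.encode
  have hc : Function.Injective c := Encodable.encode_injective
  have hinj : Function.Injective fun i => ((c i : ℕ) : Ordinal.{0}) :=
    fun i i' h => hc (Nat.cast_injective h)
  let g : M → Ordinal.{0} → ℝ := fun z =>
    Function.extend (fun i => ((c i : ℕ) : Ordinal.{0})) (fun i => coord x ε i z) 0
  have hg : ∀ z, Continuous (g z) := fun z =>
    continuous_extend_of_finite hc fun η hη => finite_lt_abs_coord hx hε hε' z hη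
  let f : M → COrdinal (Ordinal.omega0 ^ (k : Ordinal.{0})) := fun z =>
    ⟨fun t => g z t, (hg z).comp continuous_subtype_val⟩
  refine ⟨f, distortion_le (fun p q => ?_) fun p q => ?_⟩
  · rw [ContinuousMap.dist_le dist_nonneg]
    intro t
    change dist (g p t) (g q t) ≤ dist p q
    by_cases h : ∃ i, ((c i : ℕ) : Ordinal.{0}) = t
    · obtain ⟨i, hi⟩ := h
      simp only [g]
      rw [← hi, hinj.extend_apply, hinj.extend_apply, Real.dist_eq]
      exact abs_coord_sub_le x ε i p q
    · simp only [g]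
      rw [Function.extend_apply' _ _ _ h, Function.extend_apply' _ _ _ h, dist_self]
      exact dist_nonneg
  · rcases eq_or_ne p q with rfl | hpq
    · simp
    obtain ⟨i, hi⟩ := exists_le_abs_coord_sub hx hε hε' hpq
    have hmem : ((c i : ℕ) : Ordinal.{0}) ∈ Set.Icc 0 (Ordinal.omega0 ^ (k : Ordinal.{0})) := by
      refine ⟨zero_le, (Ordinal.natCast_lt_omega0 (c i)).le.trans ?_⟩
      exact Ordinal.left_le_opow _ (by exact_mod_cast hk)
    have h1 := ContinuousMap.dist_apply_le_dist (f := f p) (g := f q) ⟨_, hmem⟩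
    have h2 : dist (f p ⟨_, hmem⟩) (f q ⟨_, hmem⟩) = |coord x ε i p - coord x ε i q| := by
      change dist (g p (c i : ℕ)) (g q (c i : ℕ)) = _
      simp only [g]
      rw [hinj.extend_apply, hinj.extend_apply, Real.dist_eq]
    rw [h2] at h1
    have h3 := hi.trans h1
    rw [div_mul_eq_mul_div, div_le_iff₀ (by linarith), hεC] at h3
    have hκ : 0 < 1 / 2 - 3 / 2 * ε := by linarith
    refine le_of_mul_le_mul_left ?_ hκ
    linarith

lemma classDistortion_le_two {F : Set MetSp.{u}}
    (hF : ∀ M ∈ F, TopologicalSpace.SeparableSpace M.carrier) {k : ℕ} (hk : 1 ≤ k) :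
    classDistortion (COrdinal (Ordinal.omega0 ^ (k : Ordinal.{0}))) F ≤ 2 := by
  refine iSup₂_le fun M hM => ENNReal.le_of_forall_pos_le_add fun δ hδ _ => ?_
  have := hF M hM
  have hδ' : (0 : ℝ) < δ := hδ
  have hC : (2 : ℝ) < 2 + δ := by linarith
  have h1 : (1 : ℝ) ≤ 2 + δ := by linarith
  refine (iInf_le_of_le (2 + (δ : ℝ)) (iInf_le_of_le h1
    (iInf_le_of_le (lipEmbeds_of_two_lt hC hk) le_rfl))).trans (le_of_eq ?_)
  rw [ENNReal.ofReal_add zero_le_two hδ'.le, ENNReal.ofReal_ofNat, ENNReal.ofReal_coe_nnreal]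

lemma separableSpace_of_mem_separableBanachWith
    {P : ∀ (X : Type u) [NormedAddCommGroup X] [NormedSpace ℝ X], Prop} {M : MetSp.{u}}
    (hM : M ∈ separableBanachWith P) : TopologicalSpace.SeparableSpace M.carrier := by
  obtain ⟨X, _, _, -, hX, -, rfl⟩ := hM
  exact hX

end MetricEmbed

theorem mainTheorem2 (F : Set MetricEmbed.MetSp.{u})
    (hF : F = MetricEmbed.separableMetric ∨ F = MetricEmbed.separableBanach ∨
      F = MetricEmbed.separableCotype ∨ F = MetricEmbed.separableType ∨
      F = MetricEmbed.separableReflexive)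
    (k : ℕ) (hk : 1 ≤ k) :
    ((k : ℝ≥0∞) + 1) / (k : ℝ≥0∞) ≤
        MetricEmbed.classDistortion
          (MetricEmbed.COrdinal (Ordinal.omega0 ^ (k : Ordinal.{0}))) F ∧
      MetricEmbed.classDistortion
          (MetricEmbed.COrdinal (Ordinal.omega0 ^ (k : Ordinal.{0}))) F ≤ 2 := by
  refine ⟨MetricEmbed.le_classDistortion F hF k hk,
    MetricEmbed.classDistortion_le_two (fun M hM => ?_) hk⟩
  rcases hF with rfl | rfl | rfl | rfl | rfl
  · exact hM
  all_goals exact MetricEmbed.separableSpace_of_mem_separableBanachWith hM
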